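/- Let $\zeta\in\mathbb{R}$ and $x>0$, and let $$I_{\rm BS}(x)=\inf\Big\{\tfrac12\int_0^1 (h'(y)-\zeta)^2\,dy \;:\; h\in\mathcal{AC}[0,1],\ h(0)=0,\ \int_0^1 e^{h(y)}\,dy=x\Big\}\in[0,\infty],$$ where $\mathcal{AC}[0,1]$ is the space of absolutely continuous functions $[0,1]\to\mathbb{R}$. (i) If $x\ge 1+\frac12\zeta$, then $$I_{\rm BS}(x)=\tfrac12(\delta^2-\zeta^2)\Big(1-\frac{2\tanh(\delta/2)}{\delta+\zeta\tanh(\delta/2)}\Big)-2\zeta\log\Big(\cosh(\delta/2)+\zeta\frac{\sinh(\delta/2)}{\delta}\Big)+\zeta^2,$$ where $\delta\ge 0$ is the solution (unique in $(0,\infty)$ if $x>1+\frac12\zeta$) of $$\frac{\sinh\delta}{\delta}+2\zeta\frac{\sinh^2(\delta/2)}{\delta^2}=x.$$ The solution $-\delta$ gives the same value. (ii) If $0<x\le 1+\frac12\zeta$, then $$I_{\rm BS}(x)=2\big(\xi^2+\tfrac14\zeta^2\big)\Big(\frac{\tan\xi}{\xi+\frac12\zeta\tan\xi}-1\Big)-2\zeta\log\Big(\cos\xi+\tfrac12\zeta\frac{\sin\xi}{\xi}\Big)+\zeta^2,$$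 where $\xi\in[0,\pi)$ is the solution (unique in $(0,\pi)$ if $x<1+\frac12\zeta$) of $$\frac{\sin(2\xi)}{2\xi}\Big(1+\tfrac12\zeta\frac{\tan\xi}{\xi}\Big)=x.$$ If $\frac{2\zeta}{\pi^2}<x<1+\frac12\zeta$ (in particular if $\zeta\le 0$ and $0<x<1+\frac12\zeta$), this $\xi$ is the unique solution in $(0,\frac{\pi}{2})$. At $\xi=\frac\pi2$ (which occurs for $x=2\zeta/\pi^2$ with $\zeta>0$) the expressions in (ii) are read with the tangent cleared, that is, as $\frac{\sin\xi}{\xi}\big(\cos\xi+\frac12\zeta\frac{\sin\xi}{\xi}\big)$ and with $\frac{\sin\xi}{\xi\cos\xi+\frac12\zeta\sin\xi}$ in place of $\frac{\tan\xi}{\xi+\frac12\zeta\tan\xi}$. At the common endpoint $x=1+\frac12\zeta$ one has $\delta=0$ and $\xi=0$, all expressions are read as limits at $0$, and both cases give $$I_{\rm BS}\big(1+\tfrac12\zeta\big)=\frac{\zeta^2(4+\zeta)}{2(2+\zeta)}-2\zeta\log\big(1+\tfrac12\zeta\big).$$ -/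

import Mathlib

namespace AsianLDP

open MeasureTheory

/-- The admissible paths: absolutely continuous `h` on `[0,1]` with `h 0 = 0` and
`∫₀¹ exp (h y) dy = x`. -/
def Admissible (x : ℝ) (h : ℝ → ℝ) : Prop :=
  AbsolutelyContinuousOnInterval h 0 1 ∧ h 0 = 0 ∧ ∫ y in (0 : ℝ)..1, Real.exp (h y) = x

/-- The action `½ ∫₀¹ (h'(y) - ζ)² dy`, equal to `∞` when `h' - ζ` is not square integrable. -/
noncomputable def action (ζ : ℝ) (h : ℝ → ℝ) : ENNReal :=
  (1 / 2) * ∫⁻ y in Set.Icc (0 : ℝ) 1, ENNReal.ofReal ((deriv h y - ζ) ^ 2)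

/-- The rate function `I_BS`, with values in `[0, ∞]` (the infimum over no path is `∞`). -/
noncomputable def rateBS (ζ x : ℝ) : ENNReal :=
  ⨅ (h : ℝ → ℝ) (_ : Admissible x h), action ζ h

/-- `sinh δ / δ + 2 ζ sinh² (δ/2) / δ²`. -/
noncomputable def hypLevel (ζ δ : ℝ) : ℝ :=
  Real.sinh δ / δ + 2 * ζ * (Real.sinh (δ / 2) ^ 2 / δ ^ 2)

/-- The hyperbolic closed form of the rate function. -/
noncomputable def hypRate (ζ δ : ℝ) : ℝ :=
  1 / 2 * (δ ^ 2 - ζ ^ 2) *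
      (1 - 2 * Real.tanh (δ / 2) / (δ + ζ * Real.tanh (δ / 2)))
    - 2 * ζ * Real.log (Real.cosh (δ / 2) + ζ * (Real.sinh (δ / 2) / δ)) + ζ ^ 2

/-- `(sin 2ξ / 2ξ) (1 + ½ ζ tan ξ / ξ)`. -/
noncomputable def trigLevel (ζ ξ : ℝ) : ℝ :=
  Real.sin (2 * ξ) / (2 * ξ) * (1 + 1 / 2 * ζ * (Real.tan ξ / ξ))

/-- The trigonometric closed form of the rate function. -/
noncomputable def trigRate (ζ ξ : ℝ) : ℝ :=
  2 * (ξ ^ 2 + 1 / 4 * ζ ^ 2) * (Real.tan ξ / (ξ + 1 / 2 * ζ * Real.tan ξ) - 1)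
    - 2 * ζ * Real.log (Real.cos ξ + 1 / 2 * ζ * (Real.sin ξ / ξ)) + ζ ^ 2

/-- `trigLevel` with the tangent cleared, so that it is also meaningful at `ξ = π/2`. -/
noncomputable def trigLevel' (ζ ξ : ℝ) : ℝ :=
  Real.sin ξ / ξ * (Real.cos ξ + 1 / 2 * ζ * (Real.sin ξ / ξ))

/-- `trigRate` with the tangent cleared, so that it is also meaningful at `ξ = π/2`. -/
noncomputable def trigRate' (ζ ξ : ℝ) : ℝ :=
  2 * (ξ ^ 2 + 1 / 4 * ζ ^ 2) *
      (Real.sin ξ / (ξ * Real.cos ξ + 1 / 2 * ζ * Real.sin ξ) - 1)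
    - 2 * ζ * Real.log (Real.cos ξ + 1 / 2 * ζ * (Real.sin ξ / ξ)) + ζ ^ 2

end AsianLDP

namespace AsianLDP

open MeasureTheory Set Filter Topology

/-! The Euler-Lagrange equation with a multiplier, `h'' = λ exp h`, becomes linear in `W = exp (-h /
2)`, up to scale: `W'' = κ W`. In backward time `τ = 1 - t` the free-endpoint condition `h' 1 = ζ`
reads `W' = (ζ / 2) W` at `τ = 0`, so `W = C + (ζ / 2) S` for a Jacobi pair, hyperbolic, linear or
trigonometric according to the sign of `κ`. Since `(S / W)' = 1 / W ^ 2`, the extremal has mass `S 1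
* W 1`, and a Riccati equation integrates its action in closed form (`admissible_extremal`,
`action_extremal`).

Minimality rests on `(h' - ζ) ^ 2 / 2 ≥ (h' - ζ) b - b ^ 2 / 2` for a suitable `b`. Put `E = 2κ - ζ
^ 2 / 2`. If `E ≤ 0`, the multiplier is nonnegative and convexity of `exp` suffices
(`le_action_of_nonpos`). If `E > 0`, convexity is lost, and `b` comes from a Hamilton-Jacobi
equation for the relative remaining mass `z = exp (-h t) * ∫ₜ¹ exp h`; the resulting bound is
attained by the extremal (`integral_slopeField_sub_le_action`, `integral_slopeField_eq_cost`).

The level is `s ^ 2 * (c / s + ζ / 2)`, where `s` and `c / s` are monotone in the same direction in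
the parameter; this gives uniqueness, and the intermediate value theorem gives existence. -/

/-! ### Absolute continuity of compositions and the calibration bound -/

theorem _root_.LipschitzOnWith.comp_absolutelyContinuousOnInterval {g f : ℝ → ℝ} {s : Set ℝ}
    {a b : ℝ} {K : NNReal} (hg : LipschitzOnWith K g s)
    (hf : AbsolutelyContinuousOnInterval f a b) (hs : MapsTo f (uIcc a b) s) :
    AbsolutelyContinuousOnInterval (fun t => g (f t)) a b := by
  rw [absolutelyContinuousOnInterval_iff] at hf ⊢
  intro ε hε
  -- `K + 1` instead of `K` covers `K = 0`.
  obtain ⟨δ, hδ, h⟩ := hf (ε / (K + 1)) (by positivity)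
  refine ⟨δ, hδ, fun E hE hEδ => ?_⟩
  have h1 := h E hE hEδ
  have h2 : ∑ i ∈ Finset.range E.1, dist (g (f (E.2 i).1)) (g (f (E.2 i).2)) ≤
      K * ∑ i ∈ Finset.range E.1, dist (f (E.2 i).1) (f (E.2 i).2) := by
    rw [Finset.mul_sum]
    refine Finset.sum_le_sum fun i hi => ?_
    exact hg.dist_le_mul _ (hs (hE.1 i hi).1) _ (hs (hE.1 i hi).2)
  have h3 : (0 : ℝ) ≤ ∑ i ∈ Finset.range E.1, dist (f (E.2 i).1) (f (E.2 i).2) :=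
    Finset.sum_nonneg fun i _ => dist_nonneg
  rw [lt_div_iff₀ (by positivity)] at h1
  nlinarith

theorem _root_.ContDiff.comp_absolutelyContinuousOnInterval {g f : ℝ → ℝ} {a b : ℝ}
    (hg : ContDiff ℝ 1 g) (hf : AbsolutelyContinuousOnInterval f a b) :
    AbsolutelyContinuousOnInterval (fun t => g (f t)) a b := by
  obtain ⟨M, hM⟩ := hf.exists_bound
  obtain ⟨K, hK⟩ := (hg.contDiffOn (s := Icc (-M) M)).exists_lipschitzOnWith (by decide)
    (convex_Icc _ _) isCompact_Icc
  exact hK.comp_absolutelyContinuousOnInterval hf fun t ht => abs_le.1 (hM t ht)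

/-- Dropping the negative part only increases the integral. This passes from signed calibration
integrals to an action that may be infinite. -/
theorem ofReal_integral_le_lintegral_ofReal {α : Type*} [MeasurableSpace α] {μ : Measure α}
    {f : α → ℝ} (hf : Integrable f μ) :
    ENNReal.ofReal (∫ a, f a ∂μ) ≤ ∫⁻ a, ENNReal.ofReal (f a) ∂μ := by
  rw [integral_eq_lintegral_pos_part_sub_lintegral_neg_part hf]
  refine (ENNReal.ofReal_le_ofReal (sub_le_self _ ENNReal.toReal_nonneg)).trans
    ENNReal.ofReal_toReal_le

theorem action_eq_lintegral (ζ : ℝ) (h : ℝ → ℝ) :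
    action ζ h = ∫⁻ y in Icc (0 : ℝ) 1, ENNReal.ofReal ((deriv h y - ζ) ^ 2 / 2) := by
  unfold action
  rw [← lintegral_const_mul' _ _ (by simp)]
  congr 1
  ext y
  rw [div_eq_inv_mul, ENNReal.ofReal_mul (by norm_num), ENNReal.ofReal_inv_of_pos (by norm_num)]
  simp

/-- Weighted Young inequality: the calibration bound for the action. -/
theorem ofReal_integral_le_action {ζ : ℝ} {h b : ℝ → ℝ}
    (hh : AbsolutelyContinuousOnInterval h 0 1) (hb : ContinuousOn b (Icc 0 1)) :
    ENNReal.ofReal (∫ t in (0 : ℝ)..1, ((deriv h t - ζ) * b t - b t ^ 2 / 2)) ≤ action ζ h := by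
  have hb' : ContinuousOn b (uIcc 0 1) := by rwa [uIcc_of_le zero_le_one]
  have hi : IntervalIntegrable (fun t => (deriv h t - ζ) * b t - b t ^ 2 / 2) volume 0 1 :=
    ((hh.intervalIntegrable_deriv.sub intervalIntegrable_const).mul_continuousOn hb').sub
      ((hb'.pow 2).div_const 2).intervalIntegrable
  rw [intervalIntegral.integral_of_le zero_le_one, ← integral_Icc_eq_integral_Ioc,
    action_eq_lintegral]
  refine (ofReal_integral_le_lintegral_ofReal ?_).trans (lintegral_mono fun t => ?_)
  · exact (intervalIntegrable_iff_integrableOn_Icc_of_le zero_le_one).1 hi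
  · exact ENNReal.ofReal_le_ofReal (by nlinarith [sq_nonneg (deriv h t - ζ - b t)])

/-! ### Jacobi pairs -/

/-- A pair of solutions of `S' = C`, `C' = κ S` with `S 0 = 0` and `C 0 = 1`. -/
structure JacobiPair (κ : ℝ) (S C : ℝ → ℝ) : Prop where
  hasDerivAt_S : ∀ τ, HasDerivAt S (C τ) τ
  hasDerivAt_C : ∀ τ, HasDerivAt C (κ * S τ) τ
  S_zero : S 0 = 0
  C_zero : C 0 = 1

namespace JacobiPair

variable {κ : ℝ} {S C : ℝ → ℝ}

theorem continuous_S (p : JacobiPair κ S C) : Continuous S :=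
  continuous_iff_continuousAt.2 fun τ => (p.hasDerivAt_S τ).continuousAt

theorem continuous_C (p : JacobiPair κ S C) : Continuous C :=
  continuous_iff_continuousAt.2 fun τ => (p.hasDerivAt_C τ).continuousAt

theorem contDiff_S (p : JacobiPair κ S C) : ContDiff ℝ 1 S := by
  rw [contDiff_one_iff_deriv]
  refine ⟨fun τ => (p.hasDerivAt_S τ).differentiableAt, ?_⟩
  rw [funext fun τ => (p.hasDerivAt_S τ).deriv]
  exact p.continuous_C

theorem contDiff_C (p : JacobiPair κ S C) : ContDiff ℝ 1 C := by
  rw [contDiff_one_iff_deriv]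
  refine ⟨fun τ => (p.hasDerivAt_C τ).differentiableAt, ?_⟩
  rw [funext fun τ => (p.hasDerivAt_C τ).deriv]
  exact continuous_const.mul p.continuous_S

theorem sq_sub_mul_sq (p : JacobiPair κ S C) (τ : ℝ) : C τ ^ 2 - κ * S τ ^ 2 = 1 := by
  have hd : ∀ t, HasDerivAt (fun t => C t ^ 2 - κ * S t ^ 2) 0 t := fun t => by
    refine (((p.hasDerivAt_C t).pow 2).sub (((p.hasDerivAt_S t).pow 2).const_mul κ)).congr_deriv ?_
    norm_num; ring
  have := is_const_of_deriv_eq_zero (fun t => (hd t).differentiableAt) (fun t => (hd t).deriv) τ 0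
  simpa [p.S_zero, p.C_zero] using this

end JacobiPair

/-- The positive solution `exp (-h / 2)` (up to a constant) attached to an extremal. -/
noncomputable def field (ζ : ℝ) (S C : ℝ → ℝ) (τ : ℝ) : ℝ := C τ + ζ / 2 * S τ

/-- The extremal path through the origin generated by a Jacobi pair. -/
noncomputable def extremal (ζ : ℝ) (S C : ℝ → ℝ) (t : ℝ) : ℝ :=
  2 * Real.log (field ζ S C 1) - 2 * Real.log (field ζ S C (1 - t))

/-- The logarithmic derivative of `field`. -/
noncomputable def fieldSlope (ζ κ : ℝ) (S C : ℝ → ℝ) (τ : ℝ) : ℝ :=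
  (κ * S τ + ζ / 2 * C τ) / field ζ S C τ

/-- An antiderivative of the Lagrangian along the extremal in backward time. -/
noncomputable def cost (ζ κ : ℝ) (S C : ℝ → ℝ) (τ : ℝ) : ℝ :=
  2 * κ * τ - 2 * fieldSlope ζ κ S C τ - 2 * ζ * Real.log (field ζ S C τ) + ζ ^ 2 / 2 * τ

/-! ### Mass and action of the extremals -/

section Extremal

variable {ζ κ : ℝ} {S C : ℝ → ℝ}

theorem field_zero (p : JacobiPair κ S C) : field ζ S C 0 = 1 := by
  simp [field, p.S_zero, p.C_zero]

/-- By the first integral `C ^ 2 - κ S ^ 2 = 1`, `C / S` has derivative `-1 / S ^ 2`. Hence `field /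
S = C / S + ζ / 2` is smallest at `τ = 1`, where it is positive. -/
theorem field_pos (p : JacobiPair κ S C) (hS : ∀ τ ∈ Ioc (0 : ℝ) 1, 0 < S τ)
    (h1 : 0 < field ζ S C 1) {τ : ℝ} (hτ : τ ∈ Icc (0 : ℝ) 1) : 0 < field ζ S C τ := by
  rcases hτ.1.eq_or_lt with rfl | h0
  · rw [field_zero p]; exact one_pos
  have hd : ∀ t ∈ Ioc (0 : ℝ) 1, HasDerivAt (fun t => C t / S t) (-(1 / S t ^ 2)) t := fun t ht => by
    have hne := (hS t ht).ne'
    refine ((p.hasDerivAt_C t).div (p.hasDerivAt_S t) hne).congr_deriv ?_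
    rw [← p.sq_sub_mul_sq t]; ring
  have hanti : AntitoneOn (fun t => C t / S t) (Ioc 0 1) := by
    refine antitoneOn_of_deriv_nonpos (convex_Ioc 0 1)
      (fun t ht => (hd t ht).continuousAt.continuousWithinAt)
      (fun t ht => (hd t (interior_subset ht)).differentiableAt.differentiableWithinAt)
      (fun t ht => ?_)
    rw [(hd t (interior_subset ht)).deriv]
    have : 0 ≤ 1 / S t ^ 2 := by positivity
    linarith
  have hle : C 1 / S 1 ≤ C τ / S τ := hanti ⟨h0, hτ.2⟩ ⟨zero_lt_one, le_rfl⟩ hτ.2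
  have hS1 := hS 1 ⟨zero_lt_one, le_rfl⟩
  have hSτ := hS τ ⟨h0, hτ.2⟩
  have e1 : field ζ S C 1 = S 1 * (C 1 / S 1 + ζ / 2) := by unfold field; field_simp
  have e2 : field ζ S C τ = S τ * (C τ / S τ + ζ / 2) := by unfold field; field_simp
  rw [e1] at h1
  rw [e2]
  have := pos_of_mul_pos_right h1 hS1.le
  exact mul_pos hSτ (by linarith)

theorem hasDerivAt_field (p : JacobiPair κ S C) (τ : ℝ) :
    HasDerivAt (field ζ S C) (κ * S τ + ζ / 2 * C τ) τ :=
  (p.hasDerivAt_C τ).add ((p.hasDerivAt_S τ).const_mul (ζ / 2))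

theorem contDiff_field (p : JacobiPair κ S C) : ContDiff ℝ 1 (field ζ S C) :=
  p.contDiff_C.add (contDiff_const.mul p.contDiff_S)

theorem hasDerivAt_S_div_field (p : JacobiPair κ S C) {τ : ℝ} (h : field ζ S C τ ≠ 0) :
    HasDerivAt (fun τ => S τ / field ζ S C τ) (1 / field ζ S C τ ^ 2) τ := by
  refine ((p.hasDerivAt_S τ).div (hasDerivAt_field p τ) h).congr_deriv ?_
  rw [← p.sq_sub_mul_sq τ]; unfold field; ring

/-- The momentum `h' - ζ` of the extremal: it vanishes at `τ = 0` (transversality), and its sign is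
that of `E` when `S` and `field` are positive. -/
theorem two_mul_fieldSlope_sub {τ : ℝ} (h : field ζ S C τ ≠ 0) :
    2 * fieldSlope ζ κ S C τ - ζ = (2 * κ - ζ ^ 2 / 2) * (S τ / field ζ S C τ) := by
  unfold fieldSlope
  field_simp
  unfold field
  ring

/-- The slope `σ` solves the Riccati equation `σ' = κ - σ ^ 2`, so the term `2 σ ^ 2` of the
Lagrangian integrates to `2 κ τ - 2 σ`, and `-2 ζ σ` integrates to a logarithm. -/
theorem hasDerivAt_cost (p : JacobiPair κ S C) {τ : ℝ} (h : 0 < field ζ S C τ) :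
    HasDerivAt (cost ζ κ S C) ((2 * fieldSlope ζ κ S C τ - ζ) ^ 2 / 2) τ := by
  have h1 : HasDerivAt (fieldSlope ζ κ S C) (κ - fieldSlope ζ κ S C τ ^ 2) τ := by
    have hn : HasDerivAt (fun τ => κ * S τ + ζ / 2 * C τ) (κ * C τ + ζ / 2 * (κ * S τ)) τ :=
      ((p.hasDerivAt_S τ).const_mul κ).add ((p.hasDerivAt_C τ).const_mul (ζ / 2))
    refine (hn.div (hasDerivAt_field p τ) h.ne').congr_deriv ?_
    unfold fieldSlope
    have := h.ne'
    field_simp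
    unfold field
    ring
  have h2 := (hasDerivAt_field p τ).log h.ne'
  refine (((((hasDerivAt_id τ).const_mul (2 * κ)).sub (h1.const_mul 2)).sub
    (h2.const_mul (2 * ζ))).add ((hasDerivAt_id τ).const_mul (ζ ^ 2 / 2))).congr_deriv ?_
  change 2 * κ * 1 - 2 * (κ - fieldSlope ζ κ S C τ ^ 2) - 2 * ζ * fieldSlope ζ κ S C τ +
    ζ ^ 2 / 2 * 1 = _
  ring

theorem cost_one_sub_cost_zero (p : JacobiPair κ S C) :
    cost ζ κ S C 1 - cost ζ κ S C 0 = 2 * κ - 2 * fieldSlope ζ κ S C 1 + ζ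
      - 2 * ζ * Real.log (field ζ S C 1) + ζ ^ 2 / 2 := by
  have : fieldSlope ζ κ S C 0 = ζ / 2 := by
    simp [fieldSlope, field_zero p, p.S_zero, p.C_zero]
  simp only [cost, this, field_zero p, Real.log_one]
  ring

theorem hasDerivAt_extremal (p : JacobiPair κ S C) {t : ℝ} (h : field ζ S C (1 - t) ≠ 0) :
    HasDerivAt (extremal ζ S C) (2 * fieldSlope ζ κ S C (1 - t)) t := by
  have h1 : HasDerivAt (fun t : ℝ => field ζ S C (1 - t)) (-(κ * S (1 - t) + ζ / 2 * C (1 - t))) t := by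
    exact ((hasDerivAt_field (ζ := ζ) p (1 - t)).comp t
      ((hasDerivAt_id t).const_sub 1)).congr_deriv (by ring)
  refine (((h1.log h).const_mul 2).const_sub (2 * Real.log (field ζ S C 1))).congr_deriv ?_
  unfold fieldSlope
  ring

theorem one_sub_mem_Icc {t : ℝ} (ht : t ∈ Icc (0 : ℝ) 1) : 1 - t ∈ Icc (0 : ℝ) 1 :=
  ⟨by linarith [ht.2], by linarith [ht.1]⟩

theorem absolutelyContinuous_extremal (p : JacobiPair κ S C)
    (hpos : ∀ τ ∈ Icc (0 : ℝ) 1, 0 < field ζ S C τ) :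
    AbsolutelyContinuousOnInterval (extremal ζ S C) 0 1 := by
  refine ContDiffOn.absolutelyContinuousOnInterval ?_
  rw [uIcc_of_le zero_le_one]
  refine contDiffOn_const.sub (contDiffOn_const.mul (ContDiffOn.log ?_ ?_))
  · exact ((contDiff_field p).comp (contDiff_const.sub contDiff_id)).contDiffOn
  · exact fun t ht => (hpos _ (one_sub_mem_Icc ht)).ne'

theorem exp_extremal (hpos : ∀ τ ∈ Icc (0 : ℝ) 1, 0 < field ζ S C τ) {t : ℝ}
    (ht : t ∈ Icc (0 : ℝ) 1) :
    Real.exp (extremal ζ S C t) = field ζ S C 1 ^ 2 * (1 / field ζ S C (1 - t) ^ 2) := by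
  have h1 := hpos 1 ⟨zero_le_one, le_rfl⟩
  have h2 := hpos _ (one_sub_mem_Icc ht)
  have e : ∀ y : ℝ, 0 < y → 2 * Real.log y = Real.log (y ^ 2) := fun y hy => by
    rw [Real.log_pow]; norm_num
  rw [extremal, e _ h1, e _ h2, Real.exp_sub, Real.exp_log (by positivity),
    Real.exp_log (by positivity)]
  ring

theorem continuousOn_S_div_field (p : JacobiPair κ S C)
    (hpos : ∀ τ ∈ Icc (0 : ℝ) 1, 0 < field ζ S C τ) :
    ContinuousOn (fun τ => S τ / field ζ S C τ) (Icc 0 1) := fun τ hτ =>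
  (hasDerivAt_S_div_field p (hpos τ hτ).ne').continuousAt.continuousWithinAt

theorem admissible_extremal (p : JacobiPair κ S C)
    (hpos : ∀ τ ∈ Icc (0 : ℝ) 1, 0 < field ζ S C τ) :
    Admissible (S 1 * field ζ S C 1) (extremal ζ S C) := by
  refine ⟨absolutelyContinuous_extremal p hpos, by simp [extremal], ?_⟩
  have e : ∫ t in (0 : ℝ)..1, Real.exp (extremal ζ S C t) =
      ∫ t in (0 : ℝ)..1, field ζ S C 1 ^ 2 * (1 / field ζ S C (1 - t) ^ 2) :=
    intervalIntegral.integral_congr fun t ht =>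
      exp_extremal hpos (by rwa [uIcc_of_le zero_le_one] at ht)
  rw [e, intervalIntegral.integral_const_mul,
    intervalIntegral.integral_comp_sub_left (fun τ => 1 / field ζ S C τ ^ 2) 1, sub_self, sub_zero,
    intervalIntegral.integral_eq_sub_of_hasDerivAt (f := fun τ => S τ / field ζ S C τ)]
  · have := (hpos 1 ⟨zero_le_one, le_rfl⟩).ne'
    simp only [p.S_zero, zero_div, sub_zero]
    field_simp
  · intro t ht
    rw [uIcc_of_le zero_le_one] at ht
    exact hasDerivAt_S_div_field p (hpos t ht).ne'
  · refine ContinuousOn.intervalIntegrable ?_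
    rw [uIcc_of_le zero_le_one]
    exact continuousOn_const.div ((contDiff_field p).continuous.pow 2).continuousOn
      fun t ht => (pow_pos (hpos t ht) 2).ne'

theorem integral_extremal_lagrangian (p : JacobiPair κ S C)
    (hpos : ∀ τ ∈ Icc (0 : ℝ) 1, 0 < field ζ S C τ) :
    ∫ t in (0 : ℝ)..1, (2 * fieldSlope ζ κ S C (1 - t) - ζ) ^ 2 / 2 =
      cost ζ κ S C 1 - cost ζ κ S C 0 := by
  rw [intervalIntegral.integral_comp_sub_left
    (fun τ => (2 * fieldSlope ζ κ S C τ - ζ) ^ 2 / 2) 1, sub_self, sub_zero]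
  refine intervalIntegral.integral_eq_sub_of_hasDerivAt (fun t ht => ?_) ?_
  · rw [uIcc_of_le zero_le_one] at ht
    exact hasDerivAt_cost p (hpos t ht)
  · refine ContinuousOn.intervalIntegrable ?_
    rw [uIcc_of_le zero_le_one]
    refine ContinuousOn.congr (f := fun τ =>
      ((2 * κ - ζ ^ 2 / 2) * (S τ / field ζ S C τ)) ^ 2 / 2) ?_ fun t ht => by
        simp only [two_mul_fieldSlope_sub (hpos t ht).ne']
    exact (((continuousOn_S_div_field p hpos).const_mul _).pow 2).div_const 2

theorem continuousOn_fieldSlope_sub (p : JacobiPair κ S C)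
    (hpos : ∀ τ ∈ Icc (0 : ℝ) 1, 0 < field ζ S C τ) :
    ContinuousOn (fun t => 2 * fieldSlope ζ κ S C (1 - t) - ζ) (Icc 0 1) := by
  refine ContinuousOn.congr (f := fun t =>
      (2 * κ - ζ ^ 2 / 2) * (S (1 - t) / field ζ S C (1 - t))) ?_ fun t ht => by
        simp only [two_mul_fieldSlope_sub (hpos _ (one_sub_mem_Icc ht)).ne']
  exact ((continuousOn_S_div_field p hpos).comp (continuous_const.sub continuous_id).continuousOn
    fun t ht => one_sub_mem_Icc ht).const_mul _

theorem action_extremal (p : JacobiPair κ S C)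
    (hpos : ∀ τ ∈ Icc (0 : ℝ) 1, 0 < field ζ S C τ) :
    action ζ (extremal ζ S C) = ENNReal.ofReal (cost ζ κ S C 1 - cost ζ κ S C 0) := by
  rw [action_eq_lintegral, ← integral_extremal_lagrangian p hpos,
    intervalIntegral.integral_of_le zero_le_one, ← integral_Icc_eq_integral_Ioc,
    ofReal_integral_eq_lintegral_ofReal]
  · refine setLIntegral_congr_fun measurableSet_Icc fun t ht => ?_
    simp only [(hasDerivAt_extremal p (hpos _ (one_sub_mem_Icc ht)).ne').deriv]
  · exact (((continuousOn_fieldSlope_sub p hpos).pow 2).div_const 2).integrableOn_Icc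
  · exact Filter.Eventually.of_forall fun t => by positivity

theorem cost_nonneg (p : JacobiPair κ S C)
    (hpos : ∀ τ ∈ Icc (0 : ℝ) 1, 0 < field ζ S C τ) :
    0 ≤ cost ζ κ S C 1 - cost ζ κ S C 0 := by
  rw [← integral_extremal_lagrangian p hpos]
  exact intervalIntegral.integral_nonneg zero_le_one fun t _ => by positivity

end Extremal

/-! ### Minimality: convexity for `E ≤ 0`, Hamilton-Jacobi for `E > 0` -/

section LowerBound

variable {ζ κ : ℝ} {S C : ℝ → ℝ}

/-- Along the convex branch the extremal minimizes the action. -/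
theorem le_action_of_nonpos (p : JacobiPair κ S C)
    (hpos : ∀ τ ∈ Icc (0 : ℝ) 1, 0 < field ζ S C τ) (hE : 2 * κ - ζ ^ 2 / 2 ≤ 0) {h : ℝ → ℝ}
    (hh : Admissible (S 1 * field ζ S C 1) h) :
    ENNReal.ofReal (cost ζ κ S C 1 - cost ζ κ S C 0) ≤ action ζ h := by
  obtain ⟨hac, h0, hx⟩ := hh
  have hu : uIcc (0 : ℝ) 1 = Icc 0 1 := uIcc_of_le zero_le_one
  obtain ⟨hac', h0', hx'⟩ := admissible_extremal p hpos
  set h₀ := extremal ζ S C with hh₀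
  set E := 2 * κ - ζ ^ 2 / 2 with hEdef
  set b : ℝ → ℝ := fun t => E * (S (1 - t) / field ζ S C (1 - t)) with hb
  have hbf : ∀ t ∈ Icc (0 : ℝ) 1, 2 * fieldSlope ζ κ S C (1 - t) - ζ = b t := fun t ht =>
    two_mul_fieldSlope_sub (hpos _ (one_sub_mem_Icc ht)).ne'
  have hbC : ContDiffOn ℝ 1 b (Icc 0 1) := by
    have hs : ContDiff ℝ 1 fun t : ℝ => 1 - t := contDiff_const.sub contDiff_id
    exact contDiffOn_const.mul (((p.contDiff_S.comp hs).contDiffOn).div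
      ((contDiff_field p).comp hs).contDiffOn fun t ht => (hpos _ (one_sub_mem_Icc ht)).ne')
  have hbac : AbsolutelyContinuousOnInterval b 0 1 :=
    ContDiffOn.absolutelyContinuousOnInterval (by rwa [hu])
  have hbd : ∀ t ∈ Icc (0 : ℝ) 1, deriv b t = -(E * (1 / field ζ S C (1 - t) ^ 2)) :=
    fun t ht => by
      have h1 := ((hasDerivAt_S_div_field p (hpos _ (one_sub_mem_Icc ht)).ne').comp t
        ((hasDerivAt_id t).const_sub 1)).const_mul E
      exact (h1.congr_deriv (by ring)).deriv
  have hgac : AbsolutelyContinuousOnInterval (fun t => h t - h₀ t) 0 1 := hac.fun_sub hac'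
  have hb0 : ContinuousOn b (uIcc 0 1) := hbac.continuousOn
  refine le_trans (ENNReal.ofReal_le_ofReal ?_) (ofReal_integral_le_action hac hbC.continuousOn)
  -- With `b = h₀' - ζ`, the integrand is `b (h' - h₀') + b ^ 2 / 2`, and the second term integrates
  -- to the cost of the extremal.
  have key : ∫ t in (0 : ℝ)..1, ((deriv h t - ζ) * b t - b t ^ 2 / 2) =
      (∫ t in (0 : ℝ)..1, b t * deriv (fun t => h t - h₀ t) t) +
        (cost ζ κ S C 1 - cost ζ κ S C 0) := by
    rw [← integral_extremal_lagrangian p hpos, ← intervalIntegral.integral_add]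
    · refine intervalIntegral.integral_congr_ae ?_
      filter_upwards [hac.ae_differentiableAt] with t ht htm
      have htm' : t ∈ Icc (0 : ℝ) 1 := hu ▸ uIoc_subset_uIcc htm
      have hd := hasDerivAt_extremal p (hpos _ (one_sub_mem_Icc htm')).ne'
      have hd2 : deriv (fun t => h t - h₀ t) t = deriv h t - (b t + ζ) := by
        have := ((ht (hu ▸ htm')).hasDerivAt.sub hd).deriv
        rw [← hbf t htm']
        exact this.trans (by ring)
      rw [hd2, hbf t htm']
      ring
    · exact hgac.intervalIntegrable_deriv.continuousOn_mul hb0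
    · refine ContinuousOn.intervalIntegrable ?_
      rw [hu]
      exact ((continuousOn_fieldSlope_sub p hpos).pow 2).div_const 2
  rw [key, hbac.integral_mul_deriv_eq_deriv_mul hgac]
  have hb1 : b 1 = 0 := by simp [hb, p.S_zero]
  rw [hb1, h0, h0']
  -- Euler-Lagrange gives `b' = λ exp h₀` with `λ = -E / field 1 ^ 2 ≥ 0`. The tangent line of `exp`
  -- bounds the integrand by `λ (exp h - exp h₀)`, whose integral is zero since both paths have the
  -- same mass.
  have hle : ∫ t in (0 : ℝ)..1, deriv b t * (h t - h₀ t) ≤ 0 := by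
    have hf1 := hpos 1 ⟨zero_le_one, le_rfl⟩
    have hmono : ∫ t in (0 : ℝ)..1, deriv b t * (h t - h₀ t) ≤
        ∫ t in (0 : ℝ)..1, (-E / field ζ S C 1 ^ 2) * (Real.exp (h t) - Real.exp (h₀ t)) := by
      refine intervalIntegral.integral_mono_on zero_le_one ?_ ?_ fun t ht => ?_
      · exact hbac.intervalIntegrable_deriv.mul_continuousOn hgac.continuousOn
      · exact (continuousOn_const.mul ((hac.continuousOn.rexp).sub
          (hac'.continuousOn.rexp))).intervalIntegrable
      · have h2 : Real.exp (h₀ t) * (h t - h₀ t) ≤ Real.exp (h t) - Real.exp (h₀ t) := by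
          have h3 := Real.add_one_le_exp (h t - h₀ t)
          have h4 : Real.exp (h t) = Real.exp (h₀ t) * Real.exp (h t - h₀ t) := by
            rw [← Real.exp_add]; congr 1; ring
          rw [h4]
          nlinarith [Real.exp_pos (h₀ t)]
        have h5 : deriv b t = (-E / field ζ S C 1 ^ 2) * Real.exp (h₀ t) := by
          rw [hbd t ht, hh₀, exp_extremal hpos ht]
          field_simp
        rw [h5, mul_assoc]
        exact mul_le_mul_of_nonneg_left h2 (div_nonneg (by linarith) (by positivity))
    have hex : ∀ g : ℝ → ℝ, AbsolutelyContinuousOnInterval g 0 1 →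
        IntervalIntegrable (fun t => Real.exp (g t)) volume 0 1 := fun g hg =>
      (hg.continuousOn.rexp).intervalIntegrable
    rw [intervalIntegral.integral_const_mul,
      intervalIntegral.integral_sub (hex h hac) (hex h₀ hac'), hx, hx', sub_self, mul_zero] at hmono
    exact hmono
  linarith

/-- The slope field of the autonomous Hamilton-Jacobi equation with energy `E`, divided by the
state. -/
noncomputable def slopeField (ζ E z : ℝ) : ℝ :=
  2 * E / (Real.sqrt ((1 + ζ * z) ^ 2 + 2 * E * z ^ 2) + (1 + ζ * z))

/-- The rationalized form of the quadratic root stays regular at `z = 0`, where the denominator is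
`2`; elsewhere `E > 0` makes the square root exceed `|1 + ζ z|`. -/
theorem slopeField_denom_pos {E : ℝ} (hE : 0 < E) (ζ z : ℝ) :
    0 < Real.sqrt ((1 + ζ * z) ^ 2 + 2 * E * z ^ 2) + (1 + ζ * z) := by
  rcases eq_or_ne z 0 with rfl | hz
  · norm_num
  · have h1 : |1 + ζ * z| < Real.sqrt ((1 + ζ * z) ^ 2 + 2 * E * z ^ 2) := by
      rw [← Real.sqrt_sq_eq_abs]
      exact Real.sqrt_lt_sqrt (sq_nonneg _) (by have := sq_pos_of_ne_zero hz; nlinarith)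
    linarith [neg_abs_le (1 + ζ * z)]

theorem continuous_slopeField {E : ℝ} (hE : 0 < E) : Continuous (slopeField ζ E) := by
  unfold slopeField
  exact continuous_const.div (by fun_prop) fun z => (slopeField_denom_pos hE ζ z).ne'

theorem slopeField_eq {E : ℝ} (hE : 0 < E) (z : ℝ) :
    slopeField ζ E z * (1 + ζ * z) + (z * slopeField ζ E z) ^ 2 / 2 = E := by
  have hp := slopeField_denom_pos hE ζ z
  have hsq : Real.sqrt ((1 + ζ * z) ^ 2 + 2 * E * z ^ 2) ^ 2 = (1 + ζ * z) ^ 2 + 2 * E * z ^ 2 :=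
    Real.sq_sqrt (by positivity)
  unfold slopeField
  set R := Real.sqrt ((1 + ζ * z) ^ 2 + 2 * E * z ^ 2)
  have hne := hp.ne'
  field_simp
  linear_combination -hsq

theorem hasDerivAt_integral_slopeField {E : ℝ} (hE : 0 < E) (z : ℝ) :
    HasDerivAt (fun z => ∫ s in (0 : ℝ)..z, slopeField ζ E s) (slopeField ζ E z) z :=
  ((continuous_slopeField hE).integral_hasStrictDerivAt 0 z).hasDerivAt

theorem contDiff_integral_slopeField {E : ℝ} (hE : 0 < E) :
    ContDiff ℝ 1 fun z => ∫ s in (0 : ℝ)..z, slopeField ζ E s := by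
  rw [contDiff_one_iff_deriv]
  refine ⟨fun z => (hasDerivAt_integral_slopeField hE z).differentiableAt, ?_⟩
  rw [funext fun z => (hasDerivAt_integral_slopeField (ζ := ζ) hE z).deriv]
  exact continuous_slopeField hE

/-- The Hamilton-Jacobi lower bound for the action in terms of the remaining relative mass
`exp (-h t) * ∫ₜ¹ exp h`. -/
theorem integral_slopeField_sub_le_action {E x : ℝ} (hE : 0 < E) {h : ℝ → ℝ}
    (hh : Admissible x h) :
    ENNReal.ofReal ((∫ s in (0 : ℝ)..x, slopeField ζ E s) - E) ≤ action ζ h := by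
  obtain ⟨hac, h0, hx⟩ := hh
  have hu : uIcc (0 : ℝ) 1 = Icc 0 1 := uIcc_of_le zero_le_one
  have hcont : ContinuousOn (fun t => Real.exp (h t)) (uIcc 0 1) := hac.continuousOn.rexp
  set F : ℝ → ℝ := fun t => ∫ s in (0 : ℝ)..t, Real.exp (h s) with hF
  -- Shifting `h` by a constant scales the remaining mass, so this ratio is the only state needed.
  -- It runs from `x` to `0` with `z' = -h' z - 1`.
  set z : ℝ → ℝ := fun t => Real.exp (-h t) * (x - F t) with hz
  set Φ : ℝ → ℝ := fun z => ∫ s in (0 : ℝ)..z, slopeField ζ E s with hΦ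
  have hFac : AbsolutelyContinuousOnInterval F 0 1 :=
    hcont.intervalIntegrable.absolutelyContinuousOnInterval_intervalIntegral (by simp)
  have hzac : AbsolutelyContinuousOnInterval z 0 1 := by
    have h1 : AbsolutelyContinuousOnInterval (fun t => Real.exp (-h t)) 0 1 :=
      (Real.contDiff_exp.comp contDiff_neg).comp_absolutelyContinuousOnInterval hac
    have h2 : AbsolutelyContinuousOnInterval (fun t => x - F t) 0 1 :=
      (contDiff_const.sub contDiff_id).comp_absolutelyContinuousOnInterval hFac
    exact h1.fun_mul h2
  have hΦz : AbsolutelyContinuousOnInterval (fun t => Φ (z t)) 0 1 :=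
    (contDiff_integral_slopeField hE).comp_absolutelyContinuousOnInterval hzac
  have hzc : ContinuousOn z (Icc 0 1) := hu ▸ hzac.continuousOn
  have hb : ContinuousOn (fun t => z t * slopeField ζ E (z t)) (Icc 0 1) :=
    hzc.mul ((continuous_slopeField hE).comp_continuousOn hzc)
  refine le_trans (ENNReal.ofReal_le_ofReal (le_of_eq ?_)) (ofReal_integral_le_action hac hb)
  have key : ∫ t in (0 : ℝ)..1, ((deriv h t - ζ) * (z t * slopeField ζ E (z t)) -
      (z t * slopeField ζ E (z t)) ^ 2 / 2) = ∫ t in (0 : ℝ)..1, (-deriv (fun t => Φ (z t)) t - E) := by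
    refine intervalIntegral.integral_congr_ae ?_
    -- At interior points `exp ∘ h` is continuous in a full neighbourhood, so `F` has a two-sided
    -- derivative there.
    have hne : ∀ᵐ t : ℝ, t ≠ 1 := by simp [ae_iff, measure_singleton]
    filter_upwards [hac.ae_differentiableAt, hne] with t ht ht1 htm
    rw [uIoc_of_le zero_le_one] at htm
    have hto : t ∈ Ioo (0 : ℝ) 1 := ⟨htm.1, lt_of_le_of_ne htm.2 ht1⟩
    have htd := (ht (hu ▸ Ioo_subset_Icc_self hto)).hasDerivAt
    have hFd : HasDerivAt F (Real.exp (h t)) t := by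
      refine intervalIntegral.integral_hasDerivAt_right (ContinuousOn.intervalIntegrable ?_) ?_ ?_
      · exact hcont.mono (uIcc_subset_uIcc (by simp) (hu ▸ Ioo_subset_Icc_self hto))
      · exact ContinuousOn.stronglyMeasurableAtFilter isOpen_Ioo
          (hcont.mono (hu ▸ Ioo_subset_Icc_self)) t hto
      · exact htd.continuousAt.rexp
    have hzd : HasDerivAt z (-(deriv h t * z t) - 1) t := by
      refine (htd.neg.exp.mul (hFd.const_sub x)).congr_deriv ?_
      have : Real.exp (-h t) * Real.exp (h t) = 1 := by rw [← Real.exp_add]; simp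
      simp only [hz, Pi.neg_apply]
      linear_combination -this
    have hd := ((hasDerivAt_integral_slopeField (ζ := ζ) hE (z t)).comp t hzd).deriv
    have hd' : deriv (fun t => Φ (z t)) t = slopeField ζ E (z t) * (-(deriv h t * z t) - 1) := hd
    rw [hd']
    linear_combination -slopeField_eq (ζ := ζ) hE (z t)
  have hz1 : z 1 = 0 := by simp [hz, hF, hx]
  have hz0 : z 0 = x := by simp [hz, hF, h0]
  have hi : IntervalIntegrable (fun t => -deriv (fun t => Φ (z t)) t) volume 0 1 :=
    hΦz.intervalIntegrable_deriv.neg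
  rw [key, intervalIntegral.integral_sub hi intervalIntegrable_const,
    intervalIntegral.integral_neg, hΦz.integral_deriv_eq_sub, hz1, hz0]
  simp [hΦ]

/-- Along the extremal the state is `S * field` and the slope field is `E / field ^ 2`; the two
sides, taken up to time `τ`, have equal derivatives, so the bound is sharp at this `E`. -/
theorem integral_slopeField_eq_cost (p : JacobiPair κ S C)
    (hpos : ∀ τ ∈ Icc (0 : ℝ) 1, 0 < field ζ S C τ) (hE : 0 < 2 * κ - ζ ^ 2 / 2) :
    (∫ s in (0 : ℝ)..(S 1 * field ζ S C 1), slopeField ζ (2 * κ - ζ ^ 2 / 2) s) -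
      (2 * κ - ζ ^ 2 / 2) = cost ζ κ S C 1 - cost ζ κ S C 0 := by
  set E := 2 * κ - ζ ^ 2 / 2 with hEdef
  set Φ : ℝ → ℝ := fun z => ∫ s in (0 : ℝ)..z, slopeField ζ E s with hΦ
  have hd : ∀ τ ∈ Icc (0 : ℝ) 1,
      HasDerivAt (fun τ => cost ζ κ S C τ - Φ (S τ * field ζ S C τ) + E * τ) 0 τ := fun τ hτ => by
    have hW := hpos τ hτ
    have hw := p.sq_sub_mul_sq τ
    have hzd := (p.hasDerivAt_S τ).mul (hasDerivAt_field (ζ := ζ) p τ)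
    have hΦd := (hasDerivAt_integral_slopeField (ζ := ζ) hE (S τ * field ζ S C τ)).comp τ hzd
    refine (((hasDerivAt_cost p hW).sub hΦd).add ((hasDerivAt_id τ).const_mul E)).congr_deriv ?_
    -- Replacing `1` by `C ^ 2 - κ S ^ 2` turns the radicand into a perfect square; its root equals
    -- `field ^ 2 + (E / 2) S ^ 2`, hence is nonnegative.
    have hR : Real.sqrt ((1 + ζ * (S τ * field ζ S C τ)) ^ 2 + 2 * E * (S τ * field ζ S C τ) ^ 2) =
        C τ ^ 2 + κ * S τ ^ 2 + ζ * S τ * C τ := by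
      have h0 : 0 ≤ C τ ^ 2 + κ * S τ ^ 2 + ζ * S τ * C τ := by
        nlinarith [sq_nonneg (C τ + ζ / 2 * S τ), mul_nonneg hE.le (sq_nonneg (S τ))]
      rw [← Real.sqrt_sq h0, ← hw, hEdef]
      unfold field
      congr 1
      ring
    have hφ : slopeField ζ E (S τ * field ζ S C τ) = E / field ζ S C τ ^ 2 := by
      unfold slopeField
      rw [hR]
      have : C τ ^ 2 + κ * S τ ^ 2 + ζ * S τ * C τ + (1 + ζ * (S τ * field ζ S C τ)) =
          2 * field ζ S C τ ^ 2 := by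
        rw [← hw]; unfold field; ring
      rw [this, mul_div_mul_left _ _ two_ne_zero]
    rw [hφ, two_mul_fieldSlope_sub hW.ne', ← hEdef]
    have hne := hW.ne'
    field_simp
    rw [hEdef]
    unfold field
    ring
  have hc := (convex_Icc (0 : ℝ) 1).is_const_of_fderivWithin_eq_zero (𝕜 := ℝ)
    (f := fun τ => cost ζ κ S C τ - Φ (S τ * field ζ S C τ) + E * τ)
    (fun τ hτ => (hd τ hτ).differentiableAt.differentiableWithinAt)
    (fun τ hτ => by
      have := (hd τ hτ).hasFDerivAt.hasFDerivWithinAt (s := Icc 0 1)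
      rw [this.fderivWithin (uniqueDiffOn_Icc zero_lt_one τ hτ)]
      ext; simp) (x := 0) (y := 1) (by simp) (by simp)
  simp only [p.S_zero, zero_mul, mul_zero, mul_one] at hc
  have hΦ0 : Φ 0 = 0 := by simp [hΦ]
  change Φ _ - E = _
  linarith

/-- The rate function at the level reached by a Jacobi pair. -/
theorem rateBS_eq_cost (p : JacobiPair κ S C) (hS : ∀ τ ∈ Ioc (0 : ℝ) 1, 0 < S τ)
    (h1 : 0 < field ζ S C 1) :
    (rateBS ζ (S 1 * field ζ S C 1) : EReal) =
      ((cost ζ κ S C 1 - cost ζ κ S C 0 : ℝ) : EReal) := by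
  have hpos : ∀ τ ∈ Icc (0 : ℝ) 1, 0 < field ζ S C τ := fun τ hτ => field_pos p hS h1 hτ
  have : rateBS ζ (S 1 * field ζ S C 1) = ENNReal.ofReal (cost ζ κ S C 1 - cost ζ κ S C 0) := by
    refine le_antisymm ?_ (le_iInf₂ fun h hh => ?_)
    · exact (iInf₂_le _ (admissible_extremal p hpos)).trans (action_extremal p hpos).le
    · rcases le_or_gt (2 * κ - ζ ^ 2 / 2) 0 with hE | hE
      · exact le_action_of_nonpos p hpos hE hh
      · rw [← integral_slopeField_eq_cost p hpos hE]
        exact integral_slopeField_sub_le_action hE hh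
  rw [this, EReal.coe_ennreal_ofReal, max_eq_left (cost_nonneg p hpos)]

end LowerBound

/-! ### Closed forms of level and rate -/

section ClosedForm

/-- The level `∫₀¹ exp h` of the extremal with Jacobi data `s`, `c` at time one. -/
noncomputable def levelForm (ζ s c : ℝ) : ℝ := s * (c + ζ / 2 * s)

/-- The action of the extremal with Jacobi data `s`, `c` at time one. -/
noncomputable def rateForm (ζ κ s c : ℝ) : ℝ :=
  (2 * κ - ζ ^ 2 / 2) * (1 - s / (c + ζ / 2 * s)) - 2 * ζ * Real.log (c + ζ / 2 * s) + ζ ^ 2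

theorem rateBS_eq_rateForm {ζ κ x : ℝ} {S C : ℝ → ℝ} (p : JacobiPair κ S C)
    (hS : ∀ τ ∈ Ioc (0 : ℝ) 1, 0 < S τ) (hx : 0 < x) (h : levelForm ζ (S 1) (C 1) = x) :
    (rateBS ζ x : EReal) = ((rateForm ζ κ (S 1) (C 1) : ℝ) : EReal) := by
  have hS1 : 0 < S 1 := hS 1 ⟨zero_lt_one, le_rfl⟩
  have hW : 0 < C 1 + ζ / 2 * S 1 := by
    rw [← h] at hx
    exact pos_of_mul_pos_right hx hS1.le
  have e := rateBS_eq_cost (ζ := ζ) p hS hW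
  rw [cost_one_sub_cost_zero p] at e
  rw [← h]
  refine e.trans ?_
  congr 1
  have := two_mul_fieldSlope_sub (κ := κ) hW.ne'
  unfold field at this
  unfold rateForm field
  linear_combination -this

theorem jacobiPair_hyperbolic {u : ℝ} (hu : u ≠ 0) :
    JacobiPair (u ^ 2) (fun τ => Real.sinh (u * τ) / u) (fun τ => Real.cosh (u * τ)) where
  hasDerivAt_S τ := by
    have h := (((hasDerivAt_id τ).const_mul u).sinh).div_const u
    refine h.congr_deriv ?_
    simp only [id]
    field_simp
  hasDerivAt_C τ := by
    have h := ((hasDerivAt_id τ).const_mul u).cosh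
    refine h.congr_deriv ?_
    simp only [id]
    field_simp
  S_zero := by simp
  C_zero := by simp

theorem jacobiPair_trigonometric {ξ : ℝ} (hξ : ξ ≠ 0) :
    JacobiPair (-ξ ^ 2) (fun τ => Real.sin (ξ * τ) / ξ) (fun τ => Real.cos (ξ * τ)) where
  hasDerivAt_S τ := by
    have h := (((hasDerivAt_id τ).const_mul ξ).sin).div_const ξ
    refine h.congr_deriv ?_
    simp only [id]
    field_simp
  hasDerivAt_C τ := by
    have h := ((hasDerivAt_id τ).const_mul ξ).cos
    refine h.congr_deriv ?_
    simp only [id]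
    field_simp
  S_zero := by simp
  C_zero := by simp

theorem jacobiPair_linear : JacobiPair 0 (fun τ => τ) (fun _ => 1) where
  hasDerivAt_S τ := hasDerivAt_id τ
  hasDerivAt_C τ := by simpa using hasDerivAt_const τ (1 : ℝ)
  S_zero := rfl
  C_zero := rfl

theorem hypLevel_two_mul (ζ : ℝ) {u : ℝ} (hu : u ≠ 0) :
    hypLevel ζ (2 * u) = levelForm ζ (Real.sinh u / u) (Real.cosh u) := by
  unfold hypLevel levelForm
  rw [mul_div_cancel_left₀ u two_ne_zero, Real.sinh_two_mul]
  field_simp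

theorem hypRate_two_mul (ζ : ℝ) {u : ℝ} (hu : u ≠ 0) :
    hypRate ζ (2 * u) = rateForm ζ (u ^ 2) (Real.sinh u / u) (Real.cosh u) := by
  unfold hypRate rateForm
  have hc := (Real.cosh_pos u).ne'
  rw [mul_div_cancel_left₀ u two_ne_zero, Real.tanh_eq_sinh_div_cosh]
  have h1 : 2 * (Real.sinh u / Real.cosh u) / (2 * u + ζ * (Real.sinh u / Real.cosh u)) =
      Real.sinh u / u / (Real.cosh u + ζ / 2 * (Real.sinh u / u)) := by
    rw [← mul_div_mul_left _ _ (div_ne_zero hc (mul_ne_zero two_ne_zero hu))]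
    congr 1 <;> field_simp
  have h2 : ζ * (Real.sinh u / (2 * u)) = ζ / 2 * (Real.sinh u / u) := by field_simp
  rw [h1, h2]
  ring

theorem trigLevel'_eq (ζ ξ : ℝ) :
    trigLevel' ζ ξ = levelForm ζ (Real.sin ξ / ξ) (Real.cos ξ) := by
  unfold trigLevel' levelForm
  ring

theorem trigRate'_eq (ζ : ℝ) {ξ : ℝ} (hξ : ξ ≠ 0) :
    trigRate' ζ ξ = rateForm ζ (-ξ ^ 2) (Real.sin ξ / ξ) (Real.cos ξ) := by
  unfold trigRate' rateForm
  have h1 : Real.sin ξ / (ξ * Real.cos ξ + 1 / 2 * ζ * Real.sin ξ) =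
      Real.sin ξ / ξ / (Real.cos ξ + ζ / 2 * (Real.sin ξ / ξ)) := by
    rw [← mul_div_mul_left _ _ (inv_ne_zero hξ)]
    congr 1 <;> field_simp
  have h2 : 1 / 2 * ζ * (Real.sin ξ / ξ) = ζ / 2 * (Real.sin ξ / ξ) := by ring
  rw [h1, h2]
  ring

theorem trigLevel_eq_trigLevel' (ζ : ℝ) {ξ : ℝ} (hξ : ξ ≠ 0) (hc : Real.cos ξ ≠ 0) :
    trigLevel ζ ξ = trigLevel' ζ ξ := by
  unfold trigLevel trigLevel'
  rw [Real.sin_two_mul, Real.tan_eq_sin_div_cos]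
  field_simp

theorem trigRate_eq_trigRate' (ζ : ℝ) {ξ : ℝ} (hc : Real.cos ξ ≠ 0) :
    trigRate ζ ξ = trigRate' ζ ξ := by
  unfold trigRate trigRate'
  rw [Real.tan_eq_sin_div_cos]
  have h1 : Real.sin ξ / Real.cos ξ / (ξ + 1 / 2 * ζ * (Real.sin ξ / Real.cos ξ)) =
      Real.sin ξ / (ξ * Real.cos ξ + 1 / 2 * ζ * Real.sin ξ) := by
    rw [← mul_div_mul_left _ _ hc]
    congr 1 <;> field_simp
  rw [h1]

/-- Here `κ = (δ / 2) ^ 2`. The Jacobi pair is even in `δ`, so negative solutions are covered as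
well. -/
theorem rateBS_eq_hypRate {ζ x δ : ℝ} (hx : 0 < x) (hδ : δ ≠ 0) (h : hypLevel ζ δ = x) :
    (rateBS ζ x : EReal) = ((hypRate ζ δ : ℝ) : EReal) := by
  obtain ⟨u, rfl⟩ : ∃ u, δ = 2 * u := ⟨δ / 2, by ring⟩
  have hu : u ≠ 0 := by rintro rfl; simp at hδ
  rw [hypLevel_two_mul ζ hu] at h
  rw [hypRate_two_mul ζ hu]
  have := rateBS_eq_rateForm (ζ := ζ) (jacobiPair_hyperbolic hu) (fun τ hτ => ?_) hx
    (by simpa using h)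
  · simpa using this
  · rcases lt_or_gt_of_ne hu with hu | hu
    · exact div_pos_of_neg_of_neg (Real.sinh_neg_iff.2 (mul_neg_of_neg_of_pos hu hτ.1)) hu
    · exact div_pos (Real.sinh_pos_iff.2 (mul_pos hu hτ.1)) hu

theorem rateBS_eq_trigRate' {ζ x ξ : ℝ} (hx : 0 < x) (hξ : ξ ∈ Ioo 0 Real.pi)
    (h : trigLevel' ζ ξ = x) : (rateBS ζ x : EReal) = ((trigRate' ζ ξ : ℝ) : EReal) := by
  rw [trigLevel'_eq] at h
  rw [trigRate'_eq ζ hξ.1.ne']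
  have := rateBS_eq_rateForm (ζ := ζ) (jacobiPair_trigonometric hξ.1.ne') (fun τ hτ => ?_) hx
    (by simpa using h)
  · simpa using this
  -- `ξ < π` keeps `ξ τ` below the first positive zero of the sine.
  · refine div_pos (Real.sin_pos_of_pos_of_lt_pi (mul_pos hξ.1 hτ.1) ?_) hξ.1
    nlinarith [hξ.1, hξ.2, hτ.2]

theorem rateBS_endpoint {ζ : ℝ} (h : 0 < 1 + ζ / 2) :
    (rateBS ζ (1 + ζ / 2) : EReal) = ((rateForm ζ 0 1 1 : ℝ) : EReal) :=
  rateBS_eq_rateForm jacobiPair_linear (fun _ hτ => hτ.1) h (by simp [levelForm])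

theorem rateForm_zero_one_one {ζ : ℝ} (h : 0 < 1 + ζ / 2) :
    rateForm ζ 0 1 1 = ζ ^ 2 * (4 + ζ) / (2 * (2 + ζ)) - 2 * ζ * Real.log (1 + ζ / 2) := by
  have h2 : (2 + ζ : ℝ) ≠ 0 := by linarith
  have h3 : (1 + ζ / 2 : ℝ) = (2 + ζ) / 2 := by ring
  unfold rateForm
  rw [mul_one]
  have : (2 * 0 - ζ ^ 2 / 2) * (1 - 1 / (1 + ζ / 2)) + ζ ^ 2 = ζ ^ 2 * (4 + ζ) / (2 * (2 + ζ)) := by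
    rw [h3]
    field_simp
    ring
  linarith

end ClosedForm

/-! ### Limits at the common endpoint -/

section Limits

theorem tendsto_levelForm {ι : Type*} {l : Filter ι} (ζ : ℝ) {s c : ι → ℝ}
    (hs : Tendsto s l (𝓝 1)) (hc : Tendsto c l (𝓝 1)) :
    Tendsto (fun i => levelForm ζ (s i) (c i)) l (𝓝 (1 + ζ / 2)) := by
  have := hs.mul (hc.add (hs.const_mul (ζ / 2)))
  simpa [levelForm] using this

theorem tendsto_rateForm {ι : Type*} {l : Filter ι} {ζ : ℝ} (hζ : 0 < 1 + ζ / 2) {k s c : ι → ℝ}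
    (hk : Tendsto k l (𝓝 0)) (hs : Tendsto s l (𝓝 1)) (hc : Tendsto c l (𝓝 1)) :
    Tendsto (fun i => rateForm ζ (k i) (s i) (c i)) l (𝓝 (rateForm ζ 0 1 1)) := by
  have hW := hc.add (hs.const_mul (ζ / 2))
  have hne : 1 + ζ / 2 * 1 ≠ 0 := by rw [mul_one]; exact hζ.ne'
  exact ((((hk.const_mul 2).sub_const _).mul (tendsto_const_nhds.sub (hs.div hW hne))).sub
    ((hW.log hne).const_mul _)).add_const _

theorem tendsto_sinh_div : Tendsto (fun u : ℝ => Real.sinh u / u) (𝓝[≠] 0) (𝓝 1) := by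
  have h := hasDerivAt_iff_tendsto_slope_zero.1 (Real.hasDerivAt_sinh 0)
  simpa [div_eq_inv_mul] using h

theorem tendsto_sin_div : Tendsto (fun u : ℝ => Real.sin u / u) (𝓝[≠] 0) (𝓝 1) := by
  have h := hasDerivAt_iff_tendsto_slope_zero.1 (Real.hasDerivAt_sin 0)
  simpa [div_eq_inv_mul] using h

theorem tendsto_cosh_zero : Tendsto Real.cosh (𝓝[≠] 0) (𝓝 1) := by
  simpa using (Real.continuous_cosh.tendsto 0).mono_left nhdsWithin_le_nhds

theorem tendsto_cos_zero : Tendsto Real.cos (𝓝[≠] 0) (𝓝 1) := by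
  simpa using (Real.continuous_cos.tendsto 0).mono_left nhdsWithin_le_nhds

theorem tendsto_half_punctured : Tendsto (fun δ : ℝ => δ / 2) (𝓝[≠] 0) (𝓝[≠] 0) := by
  refine tendsto_nhdsWithin_iff.2 ⟨?_, ?_⟩
  · have : Tendsto (fun δ : ℝ => δ / 2) (𝓝 0) (𝓝 (0 / 2)) := tendsto_id.div_const 2
    rw [zero_div] at this
    exact this.mono_left nhdsWithin_le_nhds
  · filter_upwards [self_mem_nhdsWithin] with δ hδ
    exact div_ne_zero hδ two_ne_zero

theorem tendsto_sq_punctured : Tendsto (fun δ : ℝ => δ ^ 2) (𝓝[≠] 0) (𝓝 0) := by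
  simpa using ((continuous_pow 2).tendsto (0 : ℝ)).mono_left nhdsWithin_le_nhds

theorem tendsto_hypLevel (ζ : ℝ) : Tendsto (hypLevel ζ) (𝓝[≠] 0) (𝓝 (1 + ζ / 2)) := by
  refine ((tendsto_levelForm ζ tendsto_sinh_div tendsto_cosh_zero).comp
    tendsto_half_punctured).congr' ?_
  filter_upwards [self_mem_nhdsWithin] with δ hδ
  rw [Function.comp_apply, ← hypLevel_two_mul ζ (div_ne_zero hδ two_ne_zero)]
  congr 1
  ring

theorem tendsto_hypRate {ζ : ℝ} (hζ : 0 < 1 + ζ / 2) :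
    Tendsto (hypRate ζ) (𝓝[≠] 0) (𝓝 (rateForm ζ 0 1 1)) := by
  refine ((tendsto_rateForm hζ tendsto_sq_punctured tendsto_sinh_div tendsto_cosh_zero).comp
    tendsto_half_punctured).congr' ?_
  filter_upwards [self_mem_nhdsWithin] with δ hδ
  rw [Function.comp_apply, ← hypRate_two_mul ζ (div_ne_zero hδ two_ne_zero)]
  congr 1
  ring

theorem eventually_cos_ne_zero : ∀ᶠ ξ : ℝ in 𝓝[≠] 0, Real.cos ξ ≠ 0 :=
  tendsto_cos_zero.eventually_ne one_ne_zero

theorem tendsto_trigLevel' (ζ : ℝ) : Tendsto (trigLevel' ζ) (𝓝[≠] 0) (𝓝 (1 + ζ / 2)) :=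
  (tendsto_levelForm ζ tendsto_sin_div tendsto_cos_zero).congr fun ξ => (trigLevel'_eq ζ ξ).symm

theorem tendsto_trigLevel (ζ : ℝ) : Tendsto (trigLevel ζ) (𝓝[≠] 0) (𝓝 (1 + ζ / 2)) := by
  refine (tendsto_trigLevel' ζ).congr' ?_
  filter_upwards [self_mem_nhdsWithin, eventually_cos_ne_zero] with ξ hξ hc
  exact (trigLevel_eq_trigLevel' ζ hξ hc).symm

theorem tendsto_trigRate {ζ : ℝ} (hζ : 0 < 1 + ζ / 2) :
    Tendsto (trigRate ζ) (𝓝[≠] 0) (𝓝 (rateForm ζ 0 1 1)) := by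
  have hk : Tendsto (fun ξ : ℝ => -ξ ^ 2) (𝓝[≠] 0) (𝓝 0) := by
    simpa using tendsto_sq_punctured.neg
  refine (tendsto_rateForm hζ hk tendsto_sin_div tendsto_cos_zero).congr' ?_
  filter_upwards [self_mem_nhdsWithin, eventually_cos_ne_zero] with ξ hξ hc
  rw [trigRate_eq_trigRate' ζ hc, trigRate'_eq ζ hξ]

end Limits

/-! ### Existence and uniqueness of the parameters -/

section Levels

/-- The level factors as `s ^ 2 * (c / s + ζ / 2)`; positivity of the smaller level makes its second
factor positive, so the two inequalities multiply. For `ζ < 0` the levels need not be monotone where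
they are negative. -/
theorem levelForm_lt_levelForm {ζ s c s' c' : ℝ} (hs : 0 < s) (hss : s < s')
    (hcc : c / s < c' / s') (h : 0 < levelForm ζ s c) : levelForm ζ s c < levelForm ζ s' c' := by
  have hs' := hs.trans hss
  have e : ∀ a b : ℝ, 0 < a → levelForm ζ a b = a ^ 2 * (b / a + ζ / 2) := fun a b ha => by
    unfold levelForm; field_simp
  rw [e s c hs] at h ⊢
  rw [e s' c' hs']
  have hp : 0 < c / s + ζ / 2 := pos_of_mul_pos_right h (sq_nonneg s)
  have hsq : s ^ 2 < s' ^ 2 := by gcongr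
  exact mul_lt_mul hsq (by linarith) hp (sq_nonneg s')

theorem sinh_lt_mul_cosh {u : ℝ} (hu : 0 < u) : Real.sinh u < u * Real.cosh u := by
  have hd : ∀ t : ℝ, HasDerivAt (fun t => t * Real.cosh t - Real.sinh t) (t * Real.sinh t) t :=
    fun t => (((hasDerivAt_id t).mul (Real.hasDerivAt_cosh t)).sub
      (Real.hasDerivAt_sinh t)).congr_deriv (by simp)
  have hmono : StrictMonoOn (fun t => t * Real.cosh t - Real.sinh t) (Ici 0) := by
    refine strictMonoOn_of_deriv_pos (convex_Ici 0)
      (fun t _ => (hd t).continuousAt.continuousWithinAt) fun t ht => ?_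
    rw [interior_Ici] at ht
    rw [(hd t).deriv]
    exact mul_pos ht (Real.sinh_pos_iff.2 ht)
  have := hmono (by simp) hu.le hu
  simp at this
  linarith

theorem strictMonoOn_sinh_div : StrictMonoOn (fun u : ℝ => Real.sinh u / u) (Ioi 0) := by
  have hd : ∀ t ∈ Ioi (0 : ℝ), HasDerivAt (fun u : ℝ => Real.sinh u / u)
      ((Real.cosh t * t - Real.sinh t * 1) / t ^ 2) t := fun t ht =>
    (Real.hasDerivAt_sinh t).div (hasDerivAt_id t) (ne_of_gt ht)
  refine strictMonoOn_of_deriv_pos (convex_Ioi 0)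
    (fun t ht => (hd t ht).continuousAt.continuousWithinAt) fun t ht => ?_
  rw [interior_Ioi] at ht
  rw [(hd t ht).deriv]
  exact div_pos (by linarith [sinh_lt_mul_cosh ht]) (pow_pos ht 2)

theorem strictMonoOn_cosh_div :
    StrictMonoOn (fun u : ℝ => Real.cosh u / (Real.sinh u / u)) (Ioi 0) := by
  have hd : ∀ t ∈ Ioi (0 : ℝ), HasDerivAt (fun u : ℝ => u * Real.cosh u / Real.sinh u)
      (((1 * Real.cosh t + t * Real.sinh t) * Real.sinh t - t * Real.cosh t * Real.cosh t) /
        Real.sinh t ^ 2) t := fun t ht =>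
    ((hasDerivAt_id t).mul (Real.hasDerivAt_cosh t)).div (Real.hasDerivAt_sinh t)
      (Real.sinh_pos_iff.2 ht).ne'
  have h : StrictMonoOn (fun u : ℝ => u * Real.cosh u / Real.sinh u) (Ioi 0) := by
    refine strictMonoOn_of_deriv_pos (convex_Ioi 0)
      (fun t ht => (hd t ht).continuousAt.continuousWithinAt) fun t ht => ?_
    rw [interior_Ioi] at ht
    rw [(hd t ht).deriv]
    have h1 : 0 < Real.sinh t := Real.sinh_pos_iff.2 ht
    refine div_pos ?_ (pow_pos h1 2)
    have h2 := Real.self_lt_sinh_iff.2 ht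
    have h3 := Real.one_lt_cosh.2 (ne_of_gt ht)
    have h4 := Real.cosh_sq t
    have h5 : Real.sinh t < Real.cosh t * Real.sinh t := lt_mul_of_one_lt_left h1 h3
    have h6 : (1 * Real.cosh t + t * Real.sinh t) * Real.sinh t - t * Real.cosh t * Real.cosh t =
        Real.cosh t * Real.sinh t - t := by linear_combination (-t) * h4
    linarith
  refine h.congr fun t _ => ?_
  rw [div_div_eq_mul_div, mul_comm]

theorem sin_sub_mul_cos_pos {ξ : ℝ} (hξ : ξ ∈ Ioo 0 Real.pi) :
    0 < Real.sin ξ - ξ * Real.cos ξ := by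
  have hs := Real.sin_pos_of_mem_Ioo hξ
  rcases lt_or_ge ξ (Real.pi / 2) with h | h
  · have hc := Real.cos_pos_of_mem_Ioo ⟨by linarith [hξ.1, Real.pi_pos], h⟩
    have ht := Real.lt_tan hξ.1 h
    rw [Real.tan_eq_sin_div_cos, lt_div_iff₀ hc] at ht
    linarith
  · have hc := Real.cos_nonpos_of_pi_div_two_le_of_le h (by linarith [hξ.2, Real.pi_pos])
    nlinarith [hξ.1]

theorem strictAntiOn_sin_div : StrictAntiOn (fun u : ℝ => Real.sin u / u) (Ioo 0 Real.pi) := by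
  have hd : ∀ t ∈ Ioo (0 : ℝ) Real.pi, HasDerivAt (fun u : ℝ => Real.sin u / u)
      ((Real.cos t * t - Real.sin t * 1) / t ^ 2) t := fun t ht =>
    (Real.hasDerivAt_sin t).div (hasDerivAt_id t) ht.1.ne'
  refine strictAntiOn_of_deriv_neg (convex_Ioo 0 Real.pi)
    (fun t ht => (hd t ht).continuousAt.continuousWithinAt) fun t ht => ?_
  rw [interior_Ioo] at ht
  rw [(hd t ht).deriv]
  exact div_neg_of_neg_of_pos (by linarith [sin_sub_mul_cos_pos ht]) (pow_pos ht.1 2)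

theorem strictAntiOn_cos_div :
    StrictAntiOn (fun u : ℝ => Real.cos u / (Real.sin u / u)) (Ioo 0 Real.pi) := by
  have hd : ∀ t ∈ Ioo (0 : ℝ) Real.pi, HasDerivAt (fun u : ℝ => u * Real.cos u / Real.sin u)
      (((1 * Real.cos t + t * -Real.sin t) * Real.sin t - t * Real.cos t * Real.cos t) /
        Real.sin t ^ 2) t := fun t ht =>
    ((hasDerivAt_id t).mul (Real.hasDerivAt_cos t)).div (Real.hasDerivAt_sin t)
      (Real.sin_pos_of_mem_Ioo ht).ne'
  have h : StrictAntiOn (fun u : ℝ => u * Real.cos u / Real.sin u) (Ioo 0 Real.pi) := by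
    refine strictAntiOn_of_deriv_neg (convex_Ioo 0 Real.pi)
      (fun t ht => (hd t ht).continuousAt.continuousWithinAt) fun t ht => ?_
    rw [interior_Ioo] at ht
    rw [(hd t ht).deriv]
    have h1 := Real.sin_pos_of_mem_Ioo ht
    refine div_neg_of_neg_of_pos ?_ (pow_pos h1 2)
    have h2 := Real.sin_lt ht.1
    have h3 := Real.cos_le_one t
    have h4 := Real.sin_sq_add_cos_sq t
    have h5 : Real.cos t * Real.sin t ≤ Real.sin t := mul_le_of_le_one_left h1.le h3
    have h6 : (1 * Real.cos t + t * -Real.sin t) * Real.sin t - t * Real.cos t * Real.cos t =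
        Real.cos t * Real.sin t - t := by linear_combination (-t) * h4
    linarith
  refine h.congr fun t _ => ?_
  rw [div_div_eq_mul_div, mul_comm]

theorem hypLevel_injOn {ζ x δ₁ δ₂ : ℝ} (hx : 0 < x) (h₁ : 0 < δ₁) (h₂ : 0 < δ₂)
    (e₁ : hypLevel ζ δ₁ = x) (e₂ : hypLevel ζ δ₂ = x) : δ₁ = δ₂ := by
  have key : ∀ u v : ℝ, 0 < u → u < v → hypLevel ζ (2 * u) = x → hypLevel ζ (2 * v) ≠ x := by
    intro u v hu huv hux hvx
    have hv := hu.trans huv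
    rw [hypLevel_two_mul ζ hu.ne'] at hux
    rw [hypLevel_two_mul ζ hv.ne'] at hvx
    have := levelForm_lt_levelForm (ζ := ζ) (div_pos (Real.sinh_pos_iff.2 hu) hu)
      (strictMonoOn_sinh_div hu hv huv) (strictMonoOn_cosh_div hu hv huv) (hux ▸ hx)
    linarith
  have r : ∀ δ : ℝ, δ = 2 * (δ / 2) := fun δ => by ring
  rw [r δ₁] at e₁
  rw [r δ₂] at e₂
  rcases lt_trichotomy δ₁ δ₂ with h | h | h
  · exact absurd e₂ (key _ _ (by linarith) (by linarith) e₁)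
  · exact h
  · exact absurd e₁ (key _ _ (by linarith) (by linarith) e₂)

theorem trigLevel'_injOn {ζ x ξ₁ ξ₂ : ℝ} (hx : 0 < x) (h₁ : ξ₁ ∈ Ioo 0 Real.pi)
    (h₂ : ξ₂ ∈ Ioo 0 Real.pi) (e₁ : trigLevel' ζ ξ₁ = x) (e₂ : trigLevel' ζ ξ₂ = x) :
    ξ₁ = ξ₂ := by
  have key : ∀ u ∈ Ioo 0 Real.pi, ∀ v ∈ Ioo 0 Real.pi, u < v → trigLevel' ζ u = x →
      trigLevel' ζ v ≠ x := by
    intro u hu v hv huv hux hvx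
    rw [trigLevel'_eq] at hux hvx
    have := levelForm_lt_levelForm (ζ := ζ) (div_pos (Real.sin_pos_of_mem_Ioo hv) hv.1)
      (strictAntiOn_sin_div hu hv huv) (strictAntiOn_cos_div hu hv huv) (hvx ▸ hx)
    linarith
  rcases lt_trichotomy ξ₁ ξ₂ with h | h | h
  · exact absurd e₂ (key _ h₁ _ h₂ h e₁)
  · exact h
  · exact absurd e₁ (key _ h₂ _ h₁ h e₂)

theorem exists_hypLevel_eq {ζ x : ℝ} (h : 1 + ζ / 2 < x) : ∃ δ, 0 < δ ∧ hypLevel ζ δ = x := by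
  have hev : ∀ᶠ δ in 𝓝[>] (0 : ℝ), hypLevel ζ δ < x :=
    ((tendsto_hypLevel ζ).mono_left (nhdsGT_le_nhdsNE 0)).eventually_lt_const h
  obtain ⟨a, hax, ha0⟩ := (hev.and self_mem_nhdsWithin).exists
  have ha0 : 0 < a := ha0
  -- `u ≥ |ζ|` bounds the second factor of the level below by `cosh u - sinh u / 2 ≥ u / 2`, `u ≥ 2
  -- |x|` makes this at least `x`, and `u ≥ a` orders the interval.
  set u := |ζ| + 2 * |x| + a + 1 with hu
  have hζ := abs_nonneg ζ
  have hx' := abs_nonneg x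
  have hu0 : 0 < u := by positivity
  have hbig : x ≤ hypLevel ζ (2 * u) := by
    rw [hypLevel_two_mul ζ hu0.ne']
    unfold levelForm
    have h1 : 1 ≤ Real.sinh u / u := by
      rw [one_le_div hu0]; exact Real.self_le_sinh_iff.2 hu0.le
    have h2 : Real.sinh u < Real.cosh u := Real.sinh_lt_cosh u
    have h3 : u ≤ Real.sinh u := Real.self_le_sinh_iff.2 hu0.le
    have h4 : -(Real.sinh u / 2) ≤ ζ / 2 * (Real.sinh u / u) := by
      have h5 : ζ / 2 * (Real.sinh u / u) = (ζ / u) * (Real.sinh u / 2) := by ring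
      have h6 : -1 ≤ ζ / u := by
        rw [le_div_iff₀ hu0]; linarith [neg_abs_le ζ]
      rw [h5]
      nlinarith
    have h7 : u / 2 ≤ Real.cosh u + ζ / 2 * (Real.sinh u / u) := by linarith
    have h8 : x ≤ u / 2 := by linarith [le_abs_self x]
    nlinarith
  have hcont : ContinuousOn (hypLevel ζ) (Icc a (2 * u)) := by
    have hne : ∀ δ ∈ Icc a (2 * u), δ ≠ 0 := fun δ hδ => (ha0.trans_le hδ.1).ne'
    unfold hypLevel
    refine ContinuousOn.add (Real.continuous_sinh.continuousOn.div continuousOn_id hne)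
      (continuousOn_const.mul (ContinuousOn.div ?_ (continuousOn_id.pow 2) fun δ hδ =>
        pow_ne_zero 2 (hne δ hδ)))
    exact (Continuous.pow (Real.continuous_sinh.comp (continuous_id.div_const 2)) 2).continuousOn
  obtain ⟨δ, hδ, e⟩ := intermediate_value_Icc (by linarith : a ≤ 2 * u) hcont ⟨hax.le, hbig⟩
  exact ⟨δ, ha0.trans_le hδ.1, e⟩

/-- The right end `b` is left free: `π` gives general existence, `π / 2` the refined range. -/
theorem exists_trigLevel'_eq {ζ x b : ℝ} (h : x < 1 + ζ / 2) (hb : 0 < b)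
    (hbx : trigLevel' ζ b < x) : ∃ ξ ∈ Ioo 0 b, trigLevel' ζ ξ = x := by
  have hev : ∀ᶠ ξ in 𝓝[>] (0 : ℝ), x < trigLevel' ζ ξ :=
    ((tendsto_trigLevel' ζ).mono_left (nhdsGT_le_nhdsNE 0)).eventually_const_lt h
  obtain ⟨a, hax, ha⟩ := (hev.and (Ioo_mem_nhdsGT hb)).exists
  have hcont : ContinuousOn (trigLevel' ζ) (Icc a b) := by
    have hne : ∀ δ ∈ Icc a b, δ ≠ 0 := fun δ hδ => (ha.1.trans_le hδ.1).ne'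
    have hs : ContinuousOn (fun ξ : ℝ => Real.sin ξ / ξ) (Icc a b) :=
      Real.continuous_sin.continuousOn.div continuousOn_id hne
    exact hs.mul (Real.continuous_cos.continuousOn.add (continuousOn_const.mul hs))
  obtain ⟨ξ, hξ, e⟩ := intermediate_value_Ioo' ha.2.le hcont ⟨hbx, hax⟩
  exact ⟨ξ, ⟨ha.1.trans hξ.1, hξ.2⟩, e⟩

end Levels

end AsianLDP

theorem proposition3 (ζ x : ℝ) (hx : 0 < x) :
    -- (i) the hyperbolic case
    (1 + ζ / 2 < x →
      (∃! δ : ℝ, 0 < δ ∧ AsianLDP.hypLevel ζ δ = x) ∧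
      ∀ δ : ℝ, δ ≠ 0 → AsianLDP.hypLevel ζ δ = x →
        (AsianLDP.rateBS ζ x : EReal) = ((AsianLDP.hypRate ζ δ : ℝ) : EReal)) ∧
    -- (ii) the trigonometric case
    (x < 1 + ζ / 2 →
      (∃! ξ : ℝ, ξ ∈ Set.Ioo 0 Real.pi ∧ AsianLDP.trigLevel' ζ ξ = x) ∧
      (∀ ξ ∈ Set.Ioo 0 Real.pi, AsianLDP.trigLevel' ζ ξ = x →
        (AsianLDP.rateBS ζ x : EReal) = ((AsianLDP.trigRate' ζ ξ : ℝ) : EReal)) ∧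
      (2 * ζ / Real.pi ^ 2 < x →
        ∃! ξ : ℝ, ξ ∈ Set.Ioo 0 (Real.pi / 2) ∧ AsianLDP.trigLevel ζ ξ = x) ∧
      (∀ ξ ∈ Set.Ioo 0 (Real.pi / 2), AsianLDP.trigLevel ζ ξ = x →
        (AsianLDP.rateBS ζ x : EReal) = ((AsianLDP.trigRate ζ ξ : ℝ) : EReal))) ∧
    -- the common endpoint of (i) and (ii), where both formulas are read by continuity at `0`
    (x = 1 + ζ / 2 →
      ∃ r : ℝ, (AsianLDP.rateBS ζ x : EReal) = (r : EReal) ∧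
        r = ζ ^ 2 * (4 + ζ) / (2 * (2 + ζ)) - 2 * ζ * Real.log (1 + ζ / 2) ∧
        Filter.Tendsto (AsianLDP.hypLevel ζ) (nhdsWithin 0 {0}ᶜ) (nhds x) ∧
        Filter.Tendsto (AsianLDP.hypRate ζ) (nhdsWithin 0 {0}ᶜ) (nhds r) ∧
        Filter.Tendsto (AsianLDP.trigLevel ζ) (nhdsWithin 0 {0}ᶜ) (nhds x) ∧
        Filter.Tendsto (AsianLDP.trigRate ζ) (nhdsWithin 0 {0}ᶜ) (nhds r)) := by
  have hcos : ∀ ξ ∈ Set.Ioo 0 (Real.pi / 2), ξ ≠ 0 ∧ Real.cos ξ ≠ 0 ∧ ξ ∈ Set.Ioo 0 Real.pi :=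
    fun ξ hξ => ⟨hξ.1.ne',
      (Real.cos_pos_of_mem_Ioo ⟨by linarith [hξ.1, Real.pi_pos], hξ.2⟩).ne',
      hξ.1, by linarith [hξ.2, Real.pi_pos]⟩
  refine ⟨fun h => ⟨?_, fun δ hδ e => AsianLDP.rateBS_eq_hypRate hx hδ e⟩, fun h => ⟨?_, ?_, ?_, ?_⟩,
    fun h => ?_⟩
  · obtain ⟨δ, hδ, e⟩ := AsianLDP.exists_hypLevel_eq h
    exact ⟨δ, ⟨hδ, e⟩, fun δ' h' => AsianLDP.hypLevel_injOn hx h'.1 hδ h'.2 e⟩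
  -- At `ξ = π` the level is `0`, below `x`.
  · obtain ⟨ξ, hξ, e⟩ := AsianLDP.exists_trigLevel'_eq h Real.pi_pos
      (by simpa [AsianLDP.trigLevel'] using hx)
    exact ⟨ξ, ⟨hξ, e⟩, fun ξ' h' => AsianLDP.trigLevel'_injOn hx h'.1 hξ h'.2 e⟩
  · exact fun ξ hξ e => AsianLDP.rateBS_eq_trigRate' hx hξ e
  · intro h2
    have hhalf : AsianLDP.trigLevel' ζ (Real.pi / 2) = 2 * ζ / Real.pi ^ 2 := by
      have := Real.pi_ne_zero
      simp only [AsianLDP.trigLevel', Real.sin_pi_div_two, Real.cos_pi_div_two]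
      field_simp
      ring
    obtain ⟨ξ, hξ, e⟩ := AsianLDP.exists_trigLevel'_eq h Real.pi_div_two_pos (hhalf ▸ h2)
    obtain ⟨h0, hc, hπ⟩ := hcos ξ hξ
    refine ⟨ξ, ⟨hξ, (AsianLDP.trigLevel_eq_trigLevel' ζ h0 hc).trans e⟩, fun ξ' h' => ?_⟩
    obtain ⟨h0', hc', hπ'⟩ := hcos ξ' h'.1
    exact AsianLDP.trigLevel'_injOn hx hπ' hπ
      ((AsianLDP.trigLevel_eq_trigLevel' ζ h0' hc').symm.trans h'.2) e
  · intro ξ hξ e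
    obtain ⟨h0, hc, hπ⟩ := hcos ξ hξ
    rw [AsianLDP.trigRate_eq_trigRate' ζ hc]
    exact AsianLDP.rateBS_eq_trigRate' hx hπ
      ((AsianLDP.trigLevel_eq_trigLevel' ζ h0 hc).symm.trans e)
  · subst h
    exact ⟨_, AsianLDP.rateBS_endpoint hx, AsianLDP.rateForm_zero_one_one hx,
      AsianLDP.tendsto_hypLevel ζ, AsianLDP.tendsto_hypRate hx, AsianLDP.tendsto_trigLevel ζ,
      AsianLDP.tendsto_trigRate hx⟩
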